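/- For $n\ge 1$ let $S_n=\{\boldsymbol x_0,\boldsymbol x_1,\dots,\boldsymbol x_{n+1}\}\subset\{0,\pm1\}^n$, where $\boldsymbol x_0=\boldsymbol 0$, $\boldsymbol x_i=-\boldsymbol e_{n-i+1}+\sum_{j=n-i+2}^{n}\boldsymbol e_j$ for $1\le i\le n$, and $\boldsymbol x_{n+1}=(1,\dots,1)^\top$. For an integer matrix $A=(a_{ij})$ put $|A|=\max|a_{ij}|$, and call an $n\times d$ matrix $A$ a sensing matrix for $\ell$-sparse vectors if $A\boldsymbol x\ne\boldsymbol 0$ for every nonzero $\boldsymbol x\in\mathbb R^d$ with at most $\ell$ nonzero coordinates. There is an $N$ such that for all integers $n\ge N$ and all $1\le\ell\le n-1$ there is an $n\times d$ integer matrix $A=A_{n,\ell}$, $d=d(n,\ell)$, with pairwise distinct columns, which is a sensing matrix for $\ell$-sparse vectors and satisfies $|A|=2$ and $$d\ \ge\ \left(\frac{n+2}{2}\right)^{1+\frac{2}{3\ell-2}}.$$ Moreover, these matrices can be chosen so that for every $\ell\ge2$ the following holds: there are a partition of the $n+2$ points of $S_n$ into two nonempty sets $I,J$ and a bipartite graph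 $\Gamma$ with vertex set $S_n$ and parts $I,J$, having no cycle of length $\le\ell$ (that is, of girth $>\ell$, where the girth of an acyclic graph is $\infty$), such that the columns of $A_{n,\ell}$ are exactly the differences $\boldsymbol x_i-\boldsymbol x_j$ with $\boldsymbol x_i\in I$, $\boldsymbol x_j\in J$ and $\{\boldsymbol x_i,\boldsymbol x_j\}$ an edge of $\Gamma$, one column for each edge. For this family, if $\varepsilon>0$ and $\ell=\ell(n)\geq 1$ is any sequence of integers with $\ell(n)\le(\log n)^{1-\varepsilon}$ for all large $n$, then $d(n,\ell(n))/n\to\infty$ as $n\to\infty$. -/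

import Mathlib

/-- An `n × d` real matrix is a sensing matrix for `ℓ`-sparse vectors if it kills no nonzero vector
with at most `ℓ` nonzero coordinates. -/
def IsSensingMatrix {n d : ℕ} (A : Matrix (Fin n) (Fin d) ℝ) (ℓ : ℕ) : Prop :=
  ∀ x : Fin d → ℝ, x ≠ 0 → {j | x j ≠ 0}.ncard ≤ ℓ → A.mulVec x ≠ 0

/-- The sup-norm `|A| = max |a_ij|` of an integer matrix. -/
def matrixSupNorm {n d : ℕ} (A : Matrix (Fin n) (Fin d) ℤ) : ℕ :=
  Finset.univ.sup fun p : Fin n × Fin d => (A p.1 p.2).natAbs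

/-- The points `x_0 = 0, x_1, …, x_n, x_{n+1} = (1, …, 1)` of the set `S_n ⊆ {0, ±1}^n`, where
`x_i = -e_{n-i+1} + ∑_{j=n-i+2}^n e_j` for `1 ≤ i ≤ n`. Coordinates are numbered from `0` here,
so `x_i` has `-1` at the position `j` with `j + i = n`, zeros before it and ones after it; the same
rule gives `0` for `i = 0` and the all-ones vector for `i = n + 1`. -/
def gridPoint (n : ℕ) (i : Fin (n + 2)) : Fin n → ℤ := fun j =>
  if (j : ℕ) + i < n then 0 else if (j : ℕ) + i = n then -1 else 1

/-- `A` is a matrix `A(D)`, where `D` is the family of differences `x_i - x_j` of points of `S_n`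
along the edges of the graph `Γ`, which is bipartite with parts `I` and `J` (`i ∈ I`, `j ∈ J`):
there is exactly one column for each edge. Vertices of `Γ` are the indices of the points. -/
def IsEdgeDifferenceMatrix {n d : ℕ} (A : Matrix (Fin n) (Fin d) ℤ)
    (Γ : SimpleGraph (Fin (n + 2))) (I J : Set (Fin (n + 2))) : Prop :=
  ∃ e : Fin d ≃ {p : Fin (n + 2) × Fin (n + 2) // p.1 ∈ I ∧ p.2 ∈ J ∧ Γ.Adj p.1 p.2},
    ∀ c : Fin d, A.col c = gridPoint n (e c).1.1 - gridPoint n (e c).1.2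

/-! Columns are differences of points of `S_n` along the edges of a graph `Γ`, so a kernel vector is
a weighting of the arcs whose net flows `w v` at the vertices satisfy `∑ w v • x_v = 0`. The nonzero
points of `S_n` satisfy one linear relation up to scaling, and its coefficients are positive. A
kernel vector with at most `ℓ ≤ n` nonzero weights uses too few edges to connect `n + 2` vertices,
so some component misses the origin. The total flow out of a component is zero, and positivity then
kills every net flow. As the girth exceeds `ℓ`, the edges used form a forest, where zero net flow
forces zero weights (`isEdgeDifferenceMatrix_isSensingMatrix`).

It remains to find bipartite graphs of girth `> ℓ` with at least `m ^ (1 + 2 / (3ℓ - 2))` edges, `m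
= (n + 2) / 2` (`hasSensingGraph_of_large`): a complete bipartite graph for `ℓ = 2`, an edge-maximal
graph of bounded degree in the middle range (`exists_bipartite_girth`), and a star once the target
is below `15m/8`. For `ℓ = 1` the target `m ^ 3` exceeds the edge number of any bipartite graph on
`n + 2` vertices, and all nonzero vectors with entries of size at most 2 are used. -/

/-! ### Net flows and the linear relation between the points of `S_n`. -/

/-- The net weight that the weighted arcs `a c → b c` put on the vertex set `C`. -/
noncomputable def netFlow {ι V : Type*} [Fintype ι] (a b : ι → V) (z : ι → ℝ) (C : Set V) : ℝ :=
  ∑ c, z c * (C.indicator 1 (a c) - C.indicator 1 (b c))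

lemma netFlow_eq_zero_of_closed {ι V : Type*} [Fintype ι] {a b : ι → V} {z : ι → ℝ} {C : Set V}
    (h : ∀ c, z c ≠ 0 → (a c ∈ C ↔ b c ∈ C)) : netFlow a b z C = 0 := by
  refine Finset.sum_eq_zero fun c _ => ?_
  by_cases hz : z c = 0
  · simp [hz]
  · by_cases ha : a c ∈ C
    · simp [ha, (h c hz).1 ha]
    · simp [ha, mt (h c hz).2 ha]

lemma sum_mul_netFlow_singleton {ι V : Type*} [Fintype ι] [Fintype V] (a b : ι → V)
    (z : ι → ℝ) (f : V → ℝ) :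
    ∑ v, f v * netFlow a b z {v} = ∑ c, z c * (f (a c) - f (b c)) := by
  classical
  simp only [netFlow, Finset.mul_sum]
  rw [Finset.sum_comm]
  refine Finset.sum_congr rfl fun c _ => ?_
  simp only [Set.indicator_apply, Set.mem_singleton_iff, Pi.one_apply]
  simp only [mul_sub, mul_ite, mul_one, mul_zero, Finset.sum_sub_distrib, Finset.sum_ite_eq,
    Finset.mem_univ, if_true]
  ring

lemma netFlow_eq_sum_singleton {ι V : Type*} [Fintype ι] [Fintype V] (a b : ι → V)
    (z : ι → ℝ) (C : Set V) :
    netFlow a b z C = ∑ v, C.indicator 1 v * netFlow a b z {v} :=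
  (sum_mul_netFlow_singleton a b z (C.indicator 1)).symm

/-- Up to scaling there is one linear relation between the points of `S_n` other than the origin,
and its coefficients all have the same sign. -/
lemma gridPoint_relation_pos {n : ℕ} (w : Fin (n + 2) → ℝ)
    (hw : ∀ j : Fin n, ∑ v, (gridPoint n v j : ℝ) * w v = 0) :
    -- The coefficients found are `2 ^ (n - v)` for `1 ≤ v ≤ n`, and `1` for the last point.
    ∃ c : Fin (n + 2) → ℝ, ∀ v, v ≠ 0 → 0 < c v ∧ w v = c v * w (Fin.last _) := by
  -- Tail sums: row `n - v` says `w v = T (v + 1)`, so `T v = 2 * T (v + 1)` for `1 ≤ v ≤ n`.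
  set T : ℕ → ℝ := fun t => ∑ v : Fin (n + 2), if t ≤ (v : ℕ) then w v else 0 with hT
  have step (v : Fin (n + 2)) : T v = w v + T (v + 1) := by
    have : w v = ∑ u : Fin (n + 2), if u = v then w u else 0 := by simp
    rw [this, hT, ← Finset.sum_add_distrib]
    refine Finset.sum_congr rfl fun u _ => ?_
    have := Fin.ext_iff (a := u) (b := v)
    grind
  have row (v : Fin (n + 2)) (h0 : v ≠ 0) (hl : v ≠ Fin.last _) : w v = T (v + 1) := by
    have h0' : (v : ℕ) ≠ 0 := fun h => h0 (Fin.ext h)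
    have hl' : (v : ℕ) ≠ n + 1 := fun h => hl (Fin.ext h)
    have hj := hw ⟨n - v, by omega⟩
    have : ∑ u : Fin (n + 2), (gridPoint n u ⟨n - v, by omega⟩ : ℝ) * w u = T (v + 1) - w v := by
      have h1 : w v = ∑ u : Fin (n + 2), if u = v then w u else 0 := by simp
      rw [h1, hT, ← Finset.sum_sub_distrib]
      refine Finset.sum_congr rfl fun u _ => ?_
      have := Fin.ext_iff (a := u) (b := v)
      have hu := u.2
      have hv := v.2
      simp only [gridPoint]
      rcases lt_trichotomy (u : ℕ) v with h | h | h
      · rw [if_pos (by omega), if_neg (by omega), if_neg (by omega)]; simp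
      · rw [if_neg (by omega), if_pos (by omega), if_neg (by omega), if_pos (by omega)]; simp
      · rw [if_neg (by omega), if_neg (by omega), if_pos (by omega), if_neg (by omega)]; simp
    linarith
  have key : ∀ s, s ≤ n → T (n + 1 - s) = 2 ^ s * w (Fin.last _) := by
    intro s
    induction s with
    | zero =>
      intro _
      have h := step (Fin.last _)
      have h2 : T (n + 1 + 1) = 0 :=
        Finset.sum_eq_zero fun u _ => if_neg (by have := u.2; omega)
      simp only [Fin.val_last] at h
      simp [h, h2]
    | succ s ih =>
      intro hs
      have hv : n + 1 - (s + 1) < n + 2 := by omega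
      have h1 := step ⟨n + 1 - (s + 1), hv⟩
      have h2 := row ⟨n + 1 - (s + 1), hv⟩ (by rw [Ne, Fin.ext_iff]; simp; omega)
        (by rw [Ne, Fin.ext_iff]; simp; omega)
      have h3 : n + 1 - (s + 1) + 1 = n + 1 - s := by omega
      simp only [h3] at h1 h2
      rw [h1, h2, ih (by omega)]
      ring
  refine ⟨fun v => if v = Fin.last _ then 1 else 2 ^ (n - (v : ℕ)), fun v hv => ?_⟩
  by_cases hl : v = Fin.last _
  · simp [hl]
  · have hl' : (v : ℕ) ≠ n + 1 := fun h => hl (Fin.ext h)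
    have h0' : (v : ℕ) ≠ 0 := fun h => hv (Fin.ext h)
    simp only [if_neg hl]
    refine ⟨by positivity, ?_⟩
    rw [row v hv hl, ← key _ (Nat.sub_le _ _)]
    congr 1
    omega

/-! ### From large girth to the sensing property. -/

/-- The graph of the arcs that carry a nonzero weight. -/
def activeGraph {ι V : Type*} (a b : ι → V) (z : ι → ℝ) : SimpleGraph V :=
  SimpleGraph.fromEdgeSet ((fun c => s(a c, b c)) '' {c | z c ≠ 0})

lemma ncard_edgeSet_activeGraph_le {ι V : Type*} [Finite ι] (a b : ι → V) (z : ι → ℝ) :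
    (activeGraph a b z).edgeSet.ncard ≤ {c | z c ≠ 0}.ncard := by
  refine le_trans (Set.ncard_le_ncard ?_ ((Set.toFinite _).image _))
    (Set.ncard_image_le (f := fun c => s(a c, b c)) (Set.toFinite {c | z c ≠ 0}))
  rw [activeGraph, SimpleGraph.edgeSet_fromEdgeSet]
  exact Set.sdiff_subset

lemma activeGraph_adj {ι V : Type*} {a b : ι → V} {z : ι → ℝ} {c : ι} (hz : z c ≠ 0)
    (hab : a c ≠ b c) : (activeGraph a b z).Adj (a c) (b c) :=
  (SimpleGraph.fromEdgeSet_adj _).2 ⟨⟨c, hz, rfl⟩, hab⟩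

lemma isAcyclic_of_ncard_edgeSet_lt_egirth {V : Type*} [Finite V] {H Γ : SimpleGraph V}
    (hle : H ≤ Γ) (hlt : (H.edgeSet.ncard : ℕ∞) < Γ.egirth) : H.IsAcyclic := by
  classical
  have := Fintype.ofFinite V
  intro v c hc
  have h1 := (SimpleGraph.egirth_anti hle).trans (SimpleGraph.egirth_le_length hc)
  have h2 := hc.isTrail.length_le_card_edgeFinset
  rw [← SimpleGraph.coe_edgeFinset, Set.ncard_coe_finset] at hlt
  exact absurd (hlt.trans_le h1) (not_lt.2 (by exact_mod_cast h2))

/-- A weighting of the arcs of an acyclic graph with zero net flow out of every vertex is zero. -/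
lemma eq_zero_of_netFlow_eq_zero {ι V : Type*} [Fintype ι] {a b : ι → V} {z : ι → ℝ}
    (hab : ∀ c, a c ≠ b c) (hinj : Function.Injective fun c => s(a c, b c))
    (hac : (activeGraph a b z).IsAcyclic) (h0 : ∀ C, netFlow a b z C = 0) : z = 0 := by
  classical
  by_contra hne
  obtain ⟨c₀, hc₀⟩ := Function.ne_iff.1 hne
  have hadj := activeGraph_adj hc₀ (hab c₀)
  have hbr := SimpleGraph.isAcyclic_iff_forall_adj_isBridge.1 hac hadj
  rw [SimpleGraph.isBridge_iff] at hbr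
  set H' := (activeGraph a b z).deleteEdges {s(a c₀, b c₀)} with hH'
  -- Every edge is a bridge; the arc `c₀` is the only one leaving its side of the cut, so the flow
  -- there is `z c₀`.
  have hflow := h0 {u | H'.Reachable (a c₀) u}
  rw [netFlow, Finset.sum_eq_single c₀] at hflow
  · have ha : a c₀ ∈ {u | H'.Reachable (a c₀) u} := SimpleGraph.Reachable.refl _
    have hb : b c₀ ∉ {u | H'.Reachable (a c₀) u} := hbr
    rw [Set.indicator_of_mem ha, Set.indicator_of_notMem hb] at hflow
    simp at hflow
    exact hc₀ hflow
  · intro c _ hc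
    by_cases hz : z c = 0
    · simp [hz]
    have hadj' : H'.Adj (a c) (b c) := by
      rw [hH', SimpleGraph.deleteEdges_adj]
      exact ⟨activeGraph_adj hz (hab c), fun h => hc (hinj h)⟩
    have hiff : a c ∈ {u | H'.Reachable (a c₀) u} ↔ b c ∈ {u | H'.Reachable (a c₀) u} :=
      ⟨fun h => h.trans hadj'.reachable, fun h => h.trans hadj'.symm.reachable⟩
    by_cases ha : a c ∈ {u | H'.Reachable (a c₀) u}
    · rw [Set.indicator_of_mem ha, Set.indicator_of_mem (hiff.1 ha)]; simp
    · rw [Set.indicator_of_notMem ha, Set.indicator_of_notMem (mt hiff.2 ha)]; simp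
  · simp

lemma isEdgeDifferenceMatrix_isSensingMatrix {n d ℓ : ℕ} {A : Matrix (Fin n) (Fin d) ℤ}
    {Γ : SimpleGraph (Fin (n + 2))} {I J : Set (Fin (n + 2))} (hℓ : ℓ ≤ n)
    (hbip : Γ.IsBipartiteWith I J) (hg : (ℓ : ℕ∞) < Γ.egirth)
    (hA : IsEdgeDifferenceMatrix A Γ I J) :
    IsSensingMatrix (A.map (Int.cast : ℤ → ℝ)) ℓ := by
  classical
  obtain ⟨e, he⟩ := hA
  intro z hz hsupp hker
  apply hz
  set a : Fin d → Fin (n + 2) := fun c => (e c).1.1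
  set b : Fin d → Fin (n + 2) := fun c => (e c).1.2
  have haI (c) : a c ∈ I := (e c).2.1
  have hbJ (c) : b c ∈ J := (e c).2.2.1
  have hΓ (c) : Γ.Adj (a c) (b c) := (e c).2.2.2
  -- Orienting all edges from `I` to `J` excludes a pair of opposite arcs on one edge.
  have hinj : Function.Injective fun c => s(a c, b c) := by
    intro c c' h
    rcases Sym2.eq_iff.1 h with ⟨h1, h2⟩ | ⟨h1, h2⟩
    · exact e.injective (Subtype.ext (Prod.ext h1 h2))
    · exact (Set.disjoint_left.1 hbip.disjoint (haI c) (h1 ▸ hbJ c')).elim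
  have hcard : (activeGraph a b z).edgeSet.ncard ≤ ℓ :=
    (ncard_edgeSet_activeGraph_le a b z).trans hsupp
  have hle : activeGraph a b z ≤ Γ := by
    rw [activeGraph, ← Γ.fromEdgeSet_edgeSet]
    refine SimpleGraph.fromEdgeSet_mono ?_
    rintro _ ⟨c, -, rfl⟩
    exact hΓ c
  refine eq_zero_of_netFlow_eq_zero (fun c => (hΓ c).ne) hinj
    (isAcyclic_of_ncard_edgeSet_lt_egirth hle (lt_of_le_of_lt (by exact_mod_cast hcard) hg)) ?_
  have hrow (j : Fin n) : ∑ v, (gridPoint n v j : ℝ) * netFlow a b z {v} = 0 := by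
    rw [sum_mul_netFlow_singleton a b z fun v => (gridPoint n v j : ℝ)]
    have := congrFun hker j
    simp only [Matrix.mulVec, dotProduct, Matrix.map_apply, Pi.zero_apply] at this
    rw [← this]
    refine Finset.sum_congr rfl fun c _ => ?_
    have := congrFun (he c) j
    simp only [Matrix.col_apply, Pi.sub_apply] at this
    rw [this]
    push_cast
    ring
  obtain ⟨q, hq⟩ := gridPoint_relation_pos _ hrow
  -- A connected graph on `n + 2` vertices has at least `n + 1` edges, more than `ℓ`.
  have hnc : ∃ v, ¬ (activeGraph a b z).Reachable v 0 := by
    by_contra! h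
    have hconn : (activeGraph a b z).Connected :=
      ⟨fun u v => (h u).trans (h v).symm⟩
    have := hconn.card_vert_le_card_edgeSet_add_one
    rw [Nat.card_coe_set_eq, Nat.card_fin] at this
    omega
  obtain ⟨v₀, hv₀⟩ := hnc
  have hC := netFlow_eq_zero_of_closed (a := a) (b := b) (z := z)
    (C := {u | (activeGraph a b z).Reachable v₀ u}) (by
      intro c hc
      have := activeGraph_adj hc (hΓ c).ne
      exact ⟨fun h => h.trans this.reachable, fun h => h.trans this.symm.reachable⟩)
  -- The flow out of the component of `v₀`, which avoids the origin, is a positive multiple of this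
  -- one.
  have hlast : netFlow a b z {Fin.last _} = 0 := by
    by_contra hne
    rw [netFlow_eq_sum_singleton] at hC
    have hterm : ∀ v, Set.indicator {u | (activeGraph a b z).Reachable v₀ u} 1 v *
        netFlow a b z {v} = Set.indicator {u | (activeGraph a b z).Reachable v₀ u} q v *
          netFlow a b z {Fin.last _} := by
      intro v
      by_cases hv : v ∈ {u | (activeGraph a b z).Reachable v₀ u}
      · have : v ≠ 0 := by rintro rfl; exact hv₀ hv
        rw [Set.indicator_of_mem hv, Set.indicator_of_mem hv, (hq v this).2]
        simp
      · rw [Set.indicator_of_notMem hv, Set.indicator_of_notMem hv]; simp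
    simp only [hterm, ← Finset.sum_mul] at hC
    refine (mul_ne_zero (ne_of_gt ?_) hne) hC
    refine Finset.sum_pos' (fun v _ => ?_) ⟨v₀, Finset.mem_univ _, ?_⟩
    · by_cases hv : v ∈ {u | (activeGraph a b z).Reachable v₀ u}
      · rw [Set.indicator_of_mem hv]
        refine (hq v ?_).1.le
        rintro rfl
        exact hv₀ hv
      · rw [Set.indicator_of_notMem hv]
    · rw [Set.indicator_of_mem (show v₀ ∈ {u | (activeGraph a b z).Reachable v₀ u} from
        SimpleGraph.Reachable.refl _)]
      refine (hq v₀ ?_).1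
      rintro rfl
      exact hv₀ (SimpleGraph.Reachable.refl _)
  have hne0 (v) (hv : v ≠ 0) : netFlow a b z {v} = 0 := by rw [(hq v hv).2, hlast, mul_zero]
  -- The relation says nothing about the origin; its flow vanishes because the total flow does.
  have hzero : netFlow a b z {0} = 0 := by
    have := netFlow_eq_sum_singleton a b z Set.univ
    rw [netFlow_eq_zero_of_closed (by simp), Finset.sum_eq_single 0] at this
    · simpa using this.symm
    · intro v _ hv; rw [hne0 v hv, mul_zero]
    · simp
  intro C
  rw [netFlow_eq_sum_singleton]
  refine Finset.sum_eq_zero fun v _ => ?_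
  by_cases hv : v = 0
  · rw [hv, hzero, mul_zero]
  · rw [hne0 v hv, mul_zero]

/-! ### Distinct columns, sup-norm and number of columns. -/

lemma IsSensingMatrix.injective_col {n d ℓ : ℕ} {A : Matrix (Fin n) (Fin d) ℤ} (hℓ : 2 ≤ ℓ)
    (hA : IsSensingMatrix (A.map (Int.cast : ℤ → ℝ)) ℓ) : Function.Injective A.col := by
  classical
  intro c c' h
  by_contra hne
  refine hA (Pi.single c 1 - Pi.single c' 1) ?_ ?_ ?_
  · intro h0
    have := congrFun h0 c
    simp [hne] at this
  · refine le_trans (Set.ncard_le_ncard (t := {c, c'}) ?_) 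
      (((Set.ncard_insert_le c {c'}).trans (by simp)).trans hℓ)
    intro j hj
    by_contra hj'
    simp only [Set.mem_insert_iff, Set.mem_singleton_iff, not_or] at hj'
    exact hj (by simp [hj'.1, hj'.2])
  · rw [Matrix.mulVec_sub, Matrix.mulVec_single_one, Matrix.mulVec_single_one, sub_eq_zero]
    ext j
    have := congrFun h j
    simpa using this

lemma matrixSupNorm_eq_of {n d k : ℕ} {A : Matrix (Fin n) (Fin d) ℤ}
    (hle : ∀ i j, (A i j).natAbs ≤ k) (hex : ∃ i j, (A i j).natAbs = k) :
    matrixSupNorm A = k := by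
  obtain ⟨i, j, h⟩ := hex
  refine le_antisymm (Finset.sup_le fun p _ => hle p.1 p.2) ?_
  rw [← h]
  exact Finset.le_sup (f := fun p : Fin n × Fin d => (A p.1 p.2).natAbs) (Finset.mem_univ (i, j))

lemma natAbs_gridPoint_sub_le {n : ℕ} (u v : Fin (n + 2)) (j : Fin n) :
    (gridPoint n u j - gridPoint n v j).natAbs ≤ 2 := by
  simp only [gridPoint]
  split_ifs <;> decide

/-- For `u < v` the coordinate where `x_u` is `-1` is one where `x_v` is `1`. Differences with the
origin only have entries `0, ±1`, hence the demand for an edge avoiding it. -/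
lemma exists_natAbs_gridPoint_sub_eq {n : ℕ} {u v : Fin (n + 2)} (hu : u ≠ 0) (hv : v ≠ 0)
    (huv : u ≠ v) : ∃ j, (gridPoint n u j - gridPoint n v j).natAbs = 2 := by
  wlog h : u < v generalizing u v
  · obtain ⟨j, hj⟩ := this hv hu huv.symm (lt_of_le_of_ne (not_lt.1 h) huv.symm)
    exact ⟨j, by rw [← Int.natAbs_neg, neg_sub]; exact hj⟩
  have h0 : (u : ℕ) ≠ 0 := fun h => hu (Fin.ext h)
  have h1 : (u : ℕ) < v := h
  have h2 := v.2
  refine ⟨⟨n - u, by omega⟩, ?_⟩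
  simp only [gridPoint]
  rw [if_neg (by omega), if_pos (by omega), if_neg (by omega), if_neg (by omega)]
  rfl

lemma card_oriented_edges {V : Type*} {Γ : SimpleGraph V} {I J : Set V}
    (hbip : Γ.IsBipartiteWith I J) :
    Nat.card {p : V × V // p.1 ∈ I ∧ p.2 ∈ J ∧ Γ.Adj p.1 p.2} = Nat.card Γ.edgeSet := by
  refine Nat.card_eq_of_bijective (fun p => ⟨s(p.1.1, p.1.2), p.2.2.2⟩) ⟨?_, ?_⟩
  · rintro ⟨⟨u, v⟩, hu, hv, h⟩ ⟨⟨u', v'⟩, hu', hv', h'⟩ heq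
    obtain ⟨h1, h2⟩ | ⟨h1, h2⟩ := Sym2.eq_iff.1 (Subtype.ext_iff.1 heq)
    all_goals dsimp only at h1 h2; subst h1 h2
    · rfl
    · exact (Set.disjoint_left.1 hbip.disjoint hu hv').elim
  · rintro ⟨e, he⟩
    induction e with | _ u v =>
    rcases hbip.mem_of_adj he with ⟨hu, hv⟩ | ⟨hu, hv⟩
    · exact ⟨⟨(u, v), hu, hv, he⟩, rfl⟩
    · exact ⟨⟨(v, u), hv, hu, SimpleGraph.Adj.symm he⟩, Subtype.ext Sym2.eq_swap⟩

/-- A bipartite graph on the points of `S_n` of girth larger than `ℓ`, with an edge avoiding the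
origin, yields a sensing matrix with one column for each edge. -/
lemma exists_edgeDifferenceMatrix {n ℓ : ℕ} {Γ : SimpleGraph (Fin (n + 2))}
    {I J : Set (Fin (n + 2))} (h2 : 2 ≤ ℓ) (hℓ : ℓ ≤ n) (hbip : Γ.IsBipartiteWith I J)
    (hg : (ℓ : ℕ∞) < Γ.egirth) (hedge : ∃ u v, u ≠ 0 ∧ v ≠ 0 ∧ Γ.Adj u v) :
    ∃ A : Matrix (Fin n) (Fin (Nat.card Γ.edgeSet)) ℤ,
      IsSensingMatrix (A.map (Int.cast : ℤ → ℝ)) ℓ ∧ matrixSupNorm A = 2 ∧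
      Function.Injective A.col ∧ IsEdgeDifferenceMatrix A Γ I J := by
  classical
  rw [← card_oriented_edges hbip]
  set e := (Finite.equivFin {p : Fin (n + 2) × Fin (n + 2) //
    p.1 ∈ I ∧ p.2 ∈ J ∧ Γ.Adj p.1 p.2}).symm with he
  set A : Matrix (Fin n) (Fin _) ℤ :=
    Matrix.of fun j c => gridPoint n (e c).1.1 j - gridPoint n (e c).1.2 j with hA
  have hdiff : IsEdgeDifferenceMatrix A Γ I J := ⟨e, fun c => rfl⟩
  have hsens := isEdgeDifferenceMatrix_isSensingMatrix hℓ hbip hg hdiff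
  refine ⟨A, hsens, ?_, hsens.injective_col h2, hdiff⟩
  refine matrixSupNorm_eq_of (fun j c => natAbs_gridPoint_sub_le _ _ j) ?_
  obtain ⟨u, v, hu, hv, huv, huI, hvJ⟩ :
      ∃ u v, u ≠ 0 ∧ v ≠ 0 ∧ Γ.Adj u v ∧ u ∈ I ∧ v ∈ J := by
    obtain ⟨u, v, hu, hv, huv⟩ := hedge
    rcases hbip.mem_of_adj huv with ⟨h, h'⟩ | ⟨h, h'⟩
    · exact ⟨u, v, hu, hv, huv, h, h'⟩
    · exact ⟨v, u, hv, hu, huv.symm, h', h⟩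
  obtain ⟨j, hj⟩ := exists_natAbs_gridPoint_sub_eq hu hv huv.ne
  refine ⟨j, e.symm ⟨(u, v), huI, hvJ, huv⟩, ?_⟩
  simp only [hA, Matrix.of_apply, Equiv.apply_symm_apply]
  exact hj

/-! ### Adding edges, sizes of balls, and edge-maximal graphs of large girth. -/

/-- A cycle through an added edge contains a shorter walk between its ends in the old graph. -/
lemma exists_walk_length_lt_of_isCycle_sup_edge {V : Type*} {Γ : SimpleGraph V} {u v x : V}
    (huv : u ≠ v) {c : (Γ ⊔ SimpleGraph.edge u v).Walk x x} (hc : c.IsCycle)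
    (he : s(u, v) ∈ c.edges) : ∃ p : Γ.Walk u v, p.length < c.length := by
  classical
  have hu : u ∈ c.support := c.fst_mem_support_of_mem_edges he
  set c' := c.rotate u hu with hc'
  have hlen : c'.length = c.length := by
    rw [← SimpleGraph.Walk.length_edges, ← SimpleGraph.Walk.length_edges]
    exact (c.rotate_edges u hu).perm.length_eq
  have he' : s(u, v) ∈ c'.edges := (c.rotate_edges u hu).mem_iff.2 he
  have hv : v ∈ c'.support := c'.snd_mem_support_of_mem_edges he'
  have hnd : c'.edges.Nodup := (hc.rotate hu).isTrail.edges_nodup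
  have hΓ {a b : V} (p : (Γ ⊔ SimpleGraph.edge u v).Walk a b) (hp : s(u, v) ∉ p.edges) :
      ∀ e ∈ p.edges, e ∈ Γ.edgeSet := by
    intro e hep
    have h1 := p.edges_subset_edgeSet hep
    rw [SimpleGraph.edgeSet_sup] at h1
    rcases h1 with h1 | h1
    · exact h1
    · rw [SimpleGraph.edge, SimpleGraph.edgeSet_fromEdgeSet] at h1
      exact (hp (h1.1 ▸ hep)).elim
  -- The vertex `v` splits the rotated cycle into two arcs; the new edge lies on at most one, and
  -- the other lives in `Γ`.
  by_cases ht : s(u, v) ∈ (c'.takeUntil v hv).edges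
  · have hd : s(u, v) ∉ (c'.dropUntil v hv).edges := by
      rw [← c'.take_spec hv, SimpleGraph.Walk.edges_append] at hnd
      exact fun h => (List.disjoint_of_nodup_append hnd) ht h
    refine ⟨((c'.dropUntil v hv).transfer Γ (hΓ _ hd)).reverse, ?_⟩
    rw [SimpleGraph.Walk.length_reverse, SimpleGraph.Walk.length_transfer, ← hlen]
    exact SimpleGraph.Walk.length_dropUntil_lt_length hv huv.symm
  · refine ⟨(c'.takeUntil v hv).transfer Γ (hΓ _ ht), ?_⟩
    rw [SimpleGraph.Walk.length_transfer, ← hlen]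
    exact SimpleGraph.Walk.length_takeUntil_lt_length hv huv.symm

lemma edist_lt_of_egirth_sup_edge_le {V : Type*} {Γ : SimpleGraph V} {u v : V} {ℓ : ℕ}
    (huv : u ≠ v) (hg : (ℓ : ℕ∞) < Γ.egirth)
    (h : (Γ ⊔ SimpleGraph.edge u v).egirth ≤ ℓ) : Γ.edist u v < ℓ := by
  have hna : ¬ (Γ ⊔ SimpleGraph.edge u v).IsAcyclic := by
    intro h'
    rw [h'.egirth_eq_top] at h
    exact absurd h (by simp)
  obtain ⟨x, c, hc, hcl⟩ := SimpleGraph.exists_egirth_eq_length.2 hna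
  rw [hcl] at h
  by_cases he : s(u, v) ∈ c.edges
  · obtain ⟨p, hp⟩ := exists_walk_length_lt_of_isCycle_sup_edge huv hc he
    refine lt_of_le_of_lt (SimpleGraph.edist_le p) (lt_of_lt_of_le ?_ h)
    exact_mod_cast hp
  · have hΓ : ∀ e ∈ c.edges, e ∈ Γ.edgeSet := by
      intro e hep
      have h1 := c.edges_subset_edgeSet hep
      rw [SimpleGraph.edgeSet_sup] at h1
      rcases h1 with h1 | h1
      · exact h1
      · rw [SimpleGraph.edge, SimpleGraph.edgeSet_fromEdgeSet] at h1
        exact (he (h1.1 ▸ hep)).elim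
    have := SimpleGraph.egirth_le_length (hc.transfer hΓ)
    rw [SimpleGraph.Walk.length_transfer] at this
    exact absurd (hg.trans_le (this.trans h)) (lt_irrefl _)

lemma exists_adj_edist_eq {V : Type*} {Γ : SimpleGraph V} {u w : V} {t : ℕ}
    (h : Γ.edist u w = (t + 1 : ℕ)) : ∃ x, Γ.Adj w x ∧ Γ.edist u x = t := by
  obtain ⟨p, hp⟩ := SimpleGraph.exists_walk_of_edist_eq_coe h
  have hlen : p.reverse.length = t + 1 := by rw [SimpleGraph.Walk.length_reverse, hp]
  match p.reverse, hlen with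
  | .cons (v := x) hadj q, hlen =>
    refine ⟨x, hadj, le_antisymm ?_ ?_⟩
    · have := SimpleGraph.edist_le q.reverse
      rw [SimpleGraph.Walk.length_reverse] at this
      rw [SimpleGraph.Walk.length_cons, Nat.add_right_cancel_iff] at hlen
      rwa [hlen] at this
    · have := SimpleGraph.edist_triangle (G := Γ) (u := u) (v := x) (w := w)
      rw [h, SimpleGraph.edist_eq_one_iff_adj.2 hadj.symm] at this
      push_cast at this
      exact (ENat.add_le_add_iff_right (by simp)).1 this

/-- A vertex other than `u` has a neighbour closer to `u`, which leaves at most `r` neighbours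
farther out; the root `u` has at most `r` by hypothesis. -/
lemma card_sphere_le {V : Type*} [Finite V] {Γ : SimpleGraph V} {r : ℕ}
    (hdeg : ∀ v, (Γ.neighborSet v).ncard ≤ r + 1) {u : V} (hu : (Γ.neighborSet u).ncard ≤ r) :
    ∀ t : ℕ, {v | Γ.edist u v = t}.ncard ≤ r ^ t
  | 0 => by simp
  | 1 => by
    simp only [Nat.cast_one, SimpleGraph.edist_eq_one_iff_adj, pow_one]
    exact hu
  | t + 2 => by
    classical
    have := Fintype.ofFinite V
    have ih := card_sphere_le hdeg hu (t + 1)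
    have hsub : {v | Γ.edist u v = (t + 2 : ℕ)}.toFinset ⊆
        {v | Γ.edist u v = (t + 1 : ℕ)}.toFinset.biUnion
          fun w => (Γ.neighborSet w \ {x | Γ.edist u x = t}).toFinset := by
      intro v hv
      rw [Set.mem_toFinset] at hv
      obtain ⟨w, hw, hwt⟩ := exists_adj_edist_eq hv
      rw [Finset.mem_biUnion]
      refine ⟨w, by simpa using hwt, ?_⟩
      rw [Set.mem_toFinset]
      refine ⟨hw.symm, fun h => ?_⟩
      have hv' : Γ.edist u v = (t + 2 : ℕ) := hv
      have h' : Γ.edist u v = t := h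
      rw [hv'] at h'
      have : t + 2 = t := by exact_mod_cast h'
      omega
    rw [Set.ncard_eq_toFinset_card', pow_succ]
    refine (Finset.card_le_card hsub).trans ((Finset.card_biUnion_le_card_mul _ _ r ?_).trans ?_)
    · intro w hw
      rw [Set.mem_toFinset] at hw
      obtain ⟨x, hx, hxt⟩ := exists_adj_edist_eq hw
      rw [← Set.ncard_eq_toFinset_card']
      have hlt : (Γ.neighborSet w \ {x | Γ.edist u x = t}).ncard < (Γ.neighborSet w).ncard :=
        Set.ncard_lt_ncard ⟨Set.sdiff_subset, fun h => (h hx).2 hxt⟩ (Set.toFinite _)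
      have := hdeg w
      omega
    · rw [← Set.ncard_eq_toFinset_card']
      exact Nat.mul_le_mul_right r ih

lemma sum_range_pow_add_one_le {r : ℕ} (hr : 2 ≤ r) (t : ℕ) :
    ∑ i ∈ Finset.range (t + 1), r ^ i + 1 ≤ 2 * r ^ t := by
  induction t with
  | zero => simp
  | succ t ih =>
    rw [Finset.sum_range_succ]
    have : 2 * r ^ t ≤ r ^ (t + 1) := by rw [pow_succ, mul_comm]; exact Nat.mul_le_mul_left _ hr
    omega

lemma card_ball_add_one_le {V : Type*} [Finite V] {Γ : SimpleGraph V} {r : ℕ} (hr : 2 ≤ r)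
    (hdeg : ∀ v, (Γ.neighborSet v).ncard ≤ r + 1) {u : V} (hu : (Γ.neighborSet u).ncard ≤ r)
    (t : ℕ) : {v | Γ.edist u v < (t + 1 : ℕ)}.ncard + 1 ≤ 2 * r ^ t := by
  classical
  have := Fintype.ofFinite V
  refine le_trans (Nat.add_le_add_right ?_ 1) (sum_range_pow_add_one_le hr t)
  have hsub : {v | Γ.edist u v < (t + 1 : ℕ)}.toFinset ⊆
      (Finset.range (t + 1)).biUnion fun i => {v | Γ.edist u v = i}.toFinset := by
    intro v hv
    rw [Set.mem_toFinset] at hv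
    obtain ⟨i, hi⟩ := ENat.ne_top_iff_exists.1 (ne_top_of_lt (show Γ.edist u v < _ from hv))
    have hv' : Γ.edist u v < (t + 1 : ℕ) := hv
    rw [← hi] at hv'
    rw [Finset.mem_biUnion]
    exact ⟨i, Finset.mem_range.2 (by exact_mod_cast hv'), by simp [hi]⟩
  rw [Set.ncard_eq_toFinset_card']
  refine (Finset.card_le_card hsub).trans (Finset.card_biUnion_le.trans ?_)
  refine Finset.sum_le_sum fun i _ => ?_
  rw [← Set.ncard_eq_toFinset_card']
  exact card_sphere_le hdeg hu i

lemma ncard_neighborSet_sup_edge_le {V : Type*} [Finite V] {Γ : SimpleGraph V} {u v : V} {r : ℕ}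
    (hdeg : ∀ w, (Γ.neighborSet w).ncard ≤ r + 1) (hu : (Γ.neighborSet u).ncard ≤ r)
    (hv : (Γ.neighborSet v).ncard ≤ r) (w : V) :
    ((Γ ⊔ SimpleGraph.edge u v).neighborSet w).ncard ≤ r + 1 := by
  have key (y : V) (hy : (Γ.neighborSet w).ncard ≤ r)
      (hsub : (Γ ⊔ SimpleGraph.edge u v).neighborSet w ⊆ insert y (Γ.neighborSet w)) :
      ((Γ ⊔ SimpleGraph.edge u v).neighborSet w).ncard ≤ r + 1 :=
    (Set.ncard_le_ncard hsub (Set.toFinite _)).trans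
      ((Set.ncard_insert_le _ _).trans (Nat.add_le_add_right hy 1))
  by_cases hwu : w = u
  · refine key v (hwu ▸ hu) fun x hx => ?_
    simp only [SimpleGraph.mem_neighborSet, SimpleGraph.sup_adj, SimpleGraph.edge_adj] at hx
    grind [SimpleGraph.mem_neighborSet]
  by_cases hwv : w = v
  · refine key u (hwv ▸ hv) fun x hx => ?_
    simp only [SimpleGraph.mem_neighborSet, SimpleGraph.sup_adj, SimpleGraph.edge_adj] at hx
    grind [SimpleGraph.mem_neighborSet]
  refine (Set.ncard_le_ncard (fun x hx => ?_) (Set.toFinite _)).trans (hdeg w)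
  simp only [SimpleGraph.mem_neighborSet, SimpleGraph.sup_adj, SimpleGraph.edge_adj] at hx
  grind [SimpleGraph.mem_neighborSet]

lemma SimpleGraph.IsBipartiteWith.sum_ncard_neighborSet {V : Type*} [Finite V]
    {Γ : SimpleGraph V} {I J : Finset V} (h : Γ.IsBipartiteWith I J) :
    ∑ v ∈ I, (Γ.neighborSet v).ncard = Nat.card Γ.edgeSet := by
  classical
  have := Fintype.ofFinite V
  rw [Nat.card_eq_fintype_card, ← SimpleGraph.edgeFinset_card,
    ← SimpleGraph.isBipartiteWith_sum_degrees_eq_card_edges h]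
  refine Finset.sum_congr rfl fun v _ => ?_
  rw [← SimpleGraph.card_neighborSet_eq_degree, Set.ncard_eq_toFinset_card', Set.toFinset_card]

/-- The greedy lower bound: an edge-maximal bipartite graph of girth larger than `t + 1` and
maximum degree at most `r + 1` has almost all degrees in one of its parts equal to `r + 1`. -/
lemma exists_bipartite_girth {V : Type*} [Finite V] {I J : Finset V} (hIJ : Disjoint I J)
    {r t : ℕ} (hr : 2 ≤ r) (ht : 1 ≤ t) :
    ∃ Γ : SimpleGraph V, Γ.IsBipartiteWith I J ∧ ((t + 1 : ℕ) : ℕ∞) < Γ.egirth ∧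
      (∀ v, (Γ.neighborSet v).ncard ≤ r + 1) ∧
      ((r + 1) * I.card ≤ Nat.card Γ.edgeSet ∨
        (r + 1) * (J.card + 1) ≤ Nat.card Γ.edgeSet + (r + 1) * (2 * r ^ t)) := by
  classical
  have := Fintype.ofFinite V
  set P : Set (SimpleGraph V) := {Γ | Γ.IsBipartiteWith I J ∧ ((t + 1 : ℕ) : ℕ∞) < Γ.egirth ∧
      ∀ v, (Γ.neighborSet v).ncard ≤ r + 1} with hP
  have hbot : (⊥ : SimpleGraph V) ∈ P := by
    refine ⟨⟨by exact_mod_cast hIJ, fun v w h => h.elim⟩, ?_, fun v => ?_⟩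
    · rw [SimpleGraph.egirth_bot]; exact ENat.natCast_lt_top _
    · simp [SimpleGraph.neighborSet]
  obtain ⟨Γ, hmax⟩ := (Set.toFinite P).exists_maximal ⟨_, hbot⟩
  obtain ⟨hbip, hg, hdeg⟩ := hmax.prop
  refine ⟨Γ, hbip, hg, hdeg, ?_⟩
  by_cases hfull : ∀ u ∈ I, r + 1 ≤ (Γ.neighborSet u).ncard
  · left
    rw [← hbip.sum_ncard_neighborSet, mul_comm]
    exact Finset.card_nsmul_le_sum _ _ _ hfull
  right
  push Not at hfull
  obtain ⟨u, huI, hu⟩ := hfull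
  have hu' : (Γ.neighborSet u).ncard ≤ r := by omega
  -- By maximality, joining `u` to a deficient `v` must create a cycle of length at most `t + 1`, so
  -- all deficient vertices of `J` lie in a small ball around `u`.
  have hnear (v) (hvJ : v ∈ J) (hv : (Γ.neighborSet v).ncard ≤ r) :
      Γ.edist u v < (t + 1 : ℕ) := by
    have huv : u ≠ v := fun h => Finset.disjoint_left.1 hIJ huI (h ▸ hvJ)
    by_cases hadj : Γ.Adj u v
    · rw [SimpleGraph.edist_eq_one_iff_adj.2 hadj]
      exact_mod_cast (by omega : 1 < t + 1)
    refine edist_lt_of_egirth_sup_edge_le huv hg ?_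
    by_contra! hlt
    have hmem : Γ ⊔ SimpleGraph.edge u v ∈ P := by
      refine ⟨⟨hbip.disjoint, fun x y hxy => ?_⟩, hlt, ncard_neighborSet_sup_edge_le hdeg hu' hv⟩
      rcases hxy with h | h
      · exact hbip.mem_of_adj h
      · rw [SimpleGraph.edge_adj] at h
        rcases h.1 with ⟨rfl, rfl⟩ | ⟨rfl, rfl⟩
        · exact Or.inl ⟨huI, hvJ⟩
        · exact Or.inr ⟨hvJ, huI⟩
    have hle := hmax.le_of_ge hmem le_sup_left
    exact hadj (hle (Or.inr ((SimpleGraph.edge_adj u v u v).2 ⟨Or.inl ⟨rfl, rfl⟩, huv⟩)))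
  have hball := card_ball_add_one_le hr hdeg hu' t
  set B := {v | Γ.edist u v < (t + 1 : ℕ)} with hB
  have hsum : (r + 1) * (J.filter (· ∉ B)).card ≤ Nat.card Γ.edgeSet := by
    rw [← hbip.symm.sum_ncard_neighborSet, mul_comm]
    refine (Finset.card_nsmul_le_sum _ (fun v => (Γ.neighborSet v).ncard) (r + 1) ?_).trans
      (Finset.sum_le_sum_of_subset (Finset.filter_subset _ _))
    intro v hv
    rw [Finset.mem_filter] at hv
    by_contra! h
    exact hv.2 (hnear v hv.1 (by omega))
  have hcard : J.card ≤ (J.filter (· ∉ B)).card + B.ncard := by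
    rw [← Finset.card_filter_add_card_filter_not (s := J) (· ∉ B)]
    refine Nat.add_le_add_left ?_ _
    rw [Set.ncard_eq_toFinset_card']
    refine Finset.card_le_card fun v hv => ?_
    simpa using (Finset.mem_filter.1 hv).2
  calc (r + 1) * (J.card + 1) ≤ (r + 1) * ((J.filter (· ∉ B)).card + 2 * r ^ t) :=
        Nat.mul_le_mul_left _ (by omega)
    _ ≤ _ := by rw [mul_add]; exact Nat.add_le_add_right hsum _

lemma exists_adj_ne_of_ncard_neighborSet_lt {V : Type*} [Finite V] {Γ : SimpleGraph V} {o : V}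
    (h : (Γ.neighborSet o).ncard < Nat.card Γ.edgeSet) : ∃ u v, u ≠ o ∧ v ≠ o ∧ Γ.Adj u v := by
  by_contra! hno
  have hsub : Γ.edgeSet ⊆ (fun v => s(o, v)) '' Γ.neighborSet o := by
    intro e he
    induction e with | _ u v =>
    by_cases hu : u = o
    · subst hu; exact ⟨v, he, rfl⟩
    by_cases hv : v = o
    · subst hv; exact ⟨u, SimpleGraph.Adj.symm he, Sym2.eq_swap⟩
    exact (hno u v hu hv he).elim
  have := (Set.ncard_le_ncard hsub (Set.toFinite _)).trans (Set.ncard_image_le (Set.toFinite _))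
  rw [Nat.card_coe_set_eq] at h
  omega

/-! ### Graphs with enough edges for each `ℓ ≥ 2`. -/

lemma exists_balanced_partition (n : ℕ) : ∃ I J : Finset (Fin (n + 2)), I.Nonempty ∧ J.Nonempty ∧
    (I : Set (Fin (n + 2))) ∪ J = Set.univ ∧ Disjoint I J ∧
    ((n : ℝ) + 2) / 2 - 1 / 2 ≤ I.card ∧ ((n : ℝ) + 2) / 2 - 1 / 2 ≤ J.card := by
  classical
  obtain ⟨I, -, hI⟩ := Finset.exists_subset_card_eq
    (s := (Finset.univ : Finset (Fin (n + 2)))) (n := (n + 2) / 2) (by simp; omega)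
  have hJ : Iᶜ.card = n + 2 - (n + 2) / 2 := by rw [Finset.card_compl, hI, Fintype.card_fin]
  refine ⟨I, Iᶜ, Finset.card_pos.1 (by omega), Finset.card_pos.1 (by omega), ?_,
    disjoint_compl_right, ?_, ?_⟩
  · rw [Finset.coe_compl, Set.union_compl_self]
  · have : n + 1 ≤ 2 * I.card := by omega
    have : ((n + 1 : ℕ) : ℝ) ≤ ((2 * I.card : ℕ) : ℝ) := Nat.cast_le.2 this
    push_cast at this
    linarith
  · have : n + 1 ≤ 2 * Iᶜ.card := by omega
    have : ((n + 1 : ℕ) : ℝ) ≤ ((2 * Iᶜ.card : ℕ) : ℝ) := Nat.cast_le.2 this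
    push_cast at this
    linarith

/-- `Γ` is a bipartite graph on the points of `S_n` with nonempty parts, of girth larger than `ℓ`,
with an edge avoiding the origin and at least `b` edges. -/
def HasSensingGraph (n ℓ : ℕ) (b : ℝ) : Prop :=
  ∃ (Γ : SimpleGraph (Fin (n + 2))) (I J : Set (Fin (n + 2))),
    I.Nonempty ∧ J.Nonempty ∧ I ∪ J = Set.univ ∧ Γ.IsBipartiteWith I J ∧
    (ℓ : ℕ∞) < Γ.egirth ∧ (∃ u v, u ≠ 0 ∧ v ≠ 0 ∧ Γ.Adj u v) ∧ b ≤ Nat.card Γ.edgeSet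

/-- A star is acyclic, so it serves every `ℓ`. The centre is `1` because all edges of a star at `0`
would meet the origin. -/
lemma hasSensingGraph_star {n : ℕ} (ℓ : ℕ) (hn : 1 ≤ n) : HasSensingGraph n ℓ (n + 1) := by
  classical
  have h01 : (1 : Fin (n + 2)) ≠ 0 := by simp
  have hl0 : Fin.last (n + 1) ≠ 0 := by simp [Fin.ext_iff]
  have hl1 : (1 : Fin (n + 2)) ≠ Fin.last (n + 1) := by
    rw [Ne, Fin.ext_iff]; simp; omega
  have hbip : (SimpleGraph.starGraph (1 : Fin (n + 2))).IsBipartiteWith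
      (({1} : Finset (Fin (n + 2))) : Set (Fin (n + 2)))
      ((({1} : Finset (Fin (n + 2)))ᶜ : Finset _) : Set (Fin (n + 2))) := by
    refine ⟨by exact_mod_cast disjoint_compl_right, fun u v h => ?_⟩
    rw [SimpleGraph.starGraph_adj] at h
    rcases h.2 with rfl | rfl
    · exact Or.inl (by simpa using h.1.symm)
    · exact Or.inr (by simpa using h.1)
  refine ⟨SimpleGraph.starGraph 1, _, _, ⟨1, by simp⟩, ⟨0, by simp⟩,
    by rw [Finset.coe_compl, Set.union_compl_self], hbip, ?_,
    ⟨1, Fin.last _, h01, hl0, SimpleGraph.starGraph_center_adj hl1⟩, ?_⟩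
  · rw [(SimpleGraph.isAcyclic_starGraph _).egirth_eq_top]
    exact ENat.natCast_lt_top _
  · rw [← hbip.sum_ncard_neighborSet, Finset.sum_singleton]
    have : (SimpleGraph.starGraph (1 : Fin (n + 2))).neighborSet 1 = {1}ᶜ := by
      ext v
      simp [eq_comm]
    rw [this, Set.ncard_compl, Nat.card_fin, Set.ncard_singleton]
    push_cast
    linarith

lemma hasSensingGraph_complete {n : ℕ} (hn : 10 ≤ n) :
    HasSensingGraph n 2 ((((n : ℝ) + 2) / 2 - 1 / 2) ^ 2) := by
  classical
  obtain ⟨I, J, hI, hJ, hunion, hdisj, hIc, hJc⟩ := exists_balanced_partition n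
  have hn' : (10 : ℝ) ≤ n := by exact_mod_cast hn
  set Γ : SimpleGraph (Fin (n + 2)) := SimpleGraph.fromRel fun u v => u ∈ I ∧ v ∈ J with hΓ
  have hbip : Γ.IsBipartiteWith I J := by
    refine ⟨by exact_mod_cast hdisj, fun u v h => ?_⟩
    rcases (SimpleGraph.fromRel_adj _ u v).1 h with ⟨-, h | h⟩
    · exact Or.inl h
    · exact Or.inr ⟨h.2, h.1⟩
  have hcard : (((n : ℝ) + 2) / 2 - 1 / 2) ^ 2 ≤ Nat.card Γ.edgeSet := by
    rw [← hbip.sum_ncard_neighborSet]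
    have hle : I.card * J.card ≤ ∑ v ∈ I, (Γ.neighborSet v).ncard := by
      refine Finset.card_nsmul_le_sum _ _ _ fun v hv => ?_
      rw [← Set.ncard_coe_finset]
      refine Set.ncard_le_ncard (fun w hw => ?_) (Set.toFinite _)
      refine (SimpleGraph.fromRel_adj (fun u v => u ∈ I ∧ v ∈ J) v w).2
        ⟨?_, Or.inl ⟨hv, hw⟩⟩
      rintro rfl
      exact Finset.disjoint_left.1 hdisj hv hw
    refine le_trans ?_ (Nat.cast_le.2 hle)
    rw [sq]
    push_cast
    exact mul_le_mul hIc hJc (by linarith) (by positivity)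
  refine ⟨Γ, I, J, by exact_mod_cast hI, by exact_mod_cast hJ, hunion, hbip, ?_, ?_, hcard⟩
  · exact lt_of_lt_of_le (by norm_num) SimpleGraph.three_le_egirth
  · refine exists_adj_ne_of_ncard_neighborSet_lt ?_
    have h1 : (Γ.neighborSet 0).ncard ≤ n + 2 := by
      simpa using Set.ncard_le_ncard (Set.subset_univ (Γ.neighborSet 0)) (Set.toFinite _)
    have h2 : ((n + 2 : ℕ) : ℝ) < Nat.card Γ.edgeSet := by
      refine lt_of_lt_of_le ?_ hcard
      push_cast
      nlinarith
    exact lt_of_le_of_lt h1 (by exact_mod_cast h2)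

/-- If `s ≥ 18` the cube suffices, as `18 * (15/17)^3 > 12`. If `s < 18`, the size of `m = s ^ (3t +
1)` forces `t + 1 ≥ 46`, and `15s/17 ≥ 1.2` with `1.2 ^ 46 ≥ 12 * 18 ^ 2`. -/
lemma twelve_mul_sq_le {s : ℝ} {t : ℕ} (hs : 15 / 8 ≤ s ^ 2) (h0 : 0 < s) (ht : 2 ≤ t)
    (hm : (18 : ℝ) ^ 140 ≤ s ^ (3 * t + 1)) : 12 * s ^ 2 ≤ (15 * s / 17) ^ (t + 1) := by
  have hs1 : 1.36 ≤ s := by nlinarith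
  rcases le_or_gt 18 s with h18 | h18
  · have h3 : (15 * s / 17) ^ 3 ≤ (15 * s / 17) ^ (t + 1) :=
      pow_le_pow_right₀ (by linarith) (by omega)
    refine le_trans ?_ h3
    have : (15 * s / 17) ^ 3 = 3375 / 4913 * s * s ^ 2 := by ring
    rw [this]
    exact mul_le_mul_of_nonneg_right (by linarith) (sq_nonneg s)
  · have ht' : 46 ≤ t + 1 := by
      by_contra! hlt
      have h1 : s ^ (3 * t + 1) ≤ 18 ^ (3 * t + 1) := pow_le_pow_left₀ h0.le h18.le _
      have h2 : (18 : ℝ) ^ (3 * t + 1) < 18 ^ 140 := pow_lt_pow_right₀ (by norm_num) (by omega)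
      linarith
    have h1 : (1.2 : ℝ) ^ (t + 1) ≤ (15 * s / 17) ^ (t + 1) :=
      pow_le_pow_left₀ (by norm_num) (by linarith) _
    have h2 : (1.2 : ℝ) ^ 46 ≤ 1.2 ^ (t + 1) := pow_le_pow_right₀ (by norm_num) ht'
    have h3 : (3888 : ℝ) ≤ 1.2 ^ 46 := by norm_num
    nlinarith

lemma twelve_mul_pow_le {s r : ℝ} {t : ℕ} (hs : 15 / 8 ≤ s ^ 2) (h0 : 0 < s) (ht : 2 ≤ t)
    (hm : (18 : ℝ) ^ 140 ≤ s ^ (3 * t + 1)) (hr0 : 0 ≤ r) (hr : r ≤ s ^ 2 + 1 / 4) :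
    12 * r ^ (t + 1) ≤ s ^ (3 * t + 1) := by
  have h1 := twelve_mul_sq_le hs h0 ht hm
  -- The bound `15/8 ≤ s ^ 2` is exactly `1/4 ≤ (2/15) * s ^ 2`.
  have h2 : r ^ (t + 1) ≤ (17 / 15 * s ^ 2) ^ (t + 1) := pow_le_pow_left₀ hr0 (by linarith) _
  have h3 : (17 / 15 * s ^ 2) ^ (t + 1) * (15 * s / 17) ^ (t + 1) = s ^ (3 * t + 1) * s ^ 2 := by
    rw [← mul_pow, show 17 / 15 * s ^ 2 * (15 * s / 17) = s ^ 3 by ring, ← pow_mul, ← pow_add]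
    ring_nf
  have h4 : 12 * (17 / 15 * s ^ 2) ^ (t + 1) * s ^ 2 ≤ s ^ (3 * t + 1) * s ^ 2 := by
    rw [← h3]
    have : 0 ≤ (17 / 15 * s ^ 2) ^ (t + 1) := by positivity
    nlinarith
  have h5 := le_of_mul_le_mul_right h4 (by positivity)
  linarith

lemma hasSensingGraph_greedy {n t : ℕ} {s : ℝ} (hs : 15 / 8 ≤ s ^ 2) (h0 : 0 < s) (ht : 2 ≤ t)
    (hsm : s ^ (3 * t + 1) = ((n : ℝ) + 2) / 2) (hm : (18 : ℝ) ^ 140 ≤ ((n : ℝ) + 2) / 2) :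
    HasSensingGraph n (t + 1) (((n : ℝ) + 2) / 2 * s ^ 2) := by
  obtain ⟨I, J, hI, hJ, hunion, hdisj, hIc, hJc⟩ := exists_balanced_partition n
  set m : ℝ := ((n : ℝ) + 2) / 2 with hmdef
  -- The term `1/4` makes `(r + 1) * m` exceed the target `m * s ^ 2` by `m/4`, which pays for the
  -- vertices lost in the ball: `(r + 1) * 2r^t ≤ 3r^(t+1) ≤ m/4`.
  set r : ℕ := ⌊s ^ 2 + 1 / 4⌋₊ with hrdef
  have hr2 : 2 ≤ r := Nat.le_floor (by push_cast; linarith)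
  have hrle : (r : ℝ) ≤ s ^ 2 + 1 / 4 := Nat.floor_le (by positivity)
  have hrlt : s ^ 2 + 1 / 4 < r + 1 := Nat.lt_floor_add_one _
  have hr2' : (2 : ℝ) ≤ r := by exact_mod_cast hr2
  have hkey := twelve_mul_pow_le hs h0 ht (hsm ▸ hm) (by positivity) hrle
  rw [hsm, pow_succ] at hkey
  have hrt : (1 : ℝ) ≤ (r : ℝ) ^ t := one_le_pow₀ (by linarith)
  have hm2 : 2 ≤ m := le_trans (by norm_num) hm
  obtain ⟨Γ, hbip, hg, hdeg, hcard⟩ := exists_bipartite_girth hdisj hr2 (by omega : 1 ≤ t)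
  have hmain : m * s ^ 2 ≤ Nat.card Γ.edgeSet := by
    have hgain : m * s ^ 2 + m / 4 ≤ (r + 1) * m := by nlinarith
    have hrr : (r : ℝ) ≤ r ^ t * r := by nlinarith
    rcases hcard with h | h
    · have h' : (((r + 1) * I.card : ℕ) : ℝ) ≤ (Nat.card Γ.edgeSet : ℝ) := Nat.cast_le.2 h
      push_cast at h'
      have : ((r : ℝ) + 1) * (m - 1 / 2) ≤ (r + 1) * I.card :=
        mul_le_mul_of_nonneg_left hIc (by positivity)
      nlinarith
    · have h' : (((r + 1) * (J.card + 1) : ℕ) : ℝ) ≤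
          ((Nat.card Γ.edgeSet + (r + 1) * (2 * r ^ t) : ℕ) : ℝ) := Nat.cast_le.2 h
      push_cast at h'
      have h1 : ((r : ℝ) + 1) * m ≤ (r + 1) * (J.card + 1) :=
        mul_le_mul_of_nonneg_left (by linarith) (by positivity)
      have h2 : ((r : ℝ) + 1) * (2 * r ^ t) ≤ 3 * (r ^ t * r) := by nlinarith
      linarith
  refine ⟨Γ, I, J, by exact_mod_cast hI, by exact_mod_cast hJ, hunion, hbip, hg, ?_, hmain⟩
  refine exists_adj_ne_of_ncard_neighborSet_lt (lt_of_le_of_lt (hdeg 0) ?_)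
  have : ((r + 1 : ℕ) : ℝ) < Nat.card Γ.edgeSet := by
    push_cast
    nlinarith
  exact_mod_cast this

lemma hasSensingGraph_of_large {n ℓ : ℕ} (hn : 2 * 18 ^ 140 ≤ n) (hℓ : 2 ≤ ℓ) :
    HasSensingGraph n ℓ ((((n : ℝ) + 2) / 2) ^ (1 + 2 / (3 * (ℓ : ℝ) - 2))) := by
  obtain ⟨t, rfl⟩ : ∃ t, ℓ = t + 1 := ⟨ℓ - 1, by omega⟩
  have ht : 1 ≤ t := by omega
  set m : ℝ := ((n : ℝ) + 2) / 2 with hmdef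
  have hm : (18 : ℝ) ^ 140 ≤ m := by
    have : ((2 * 18 ^ 140 : ℕ) : ℝ) ≤ n := Nat.cast_le.2 hn
    push_cast at this
    rw [hmdef]
    linarith
  have hm16 : (16 : ℝ) ≤ m := le_trans (by norm_num) hm
  have hm0 : 0 < m := by linarith
  have hn10 : 10 ≤ n := le_trans (by norm_num) hn
  -- Since `3ℓ - 2 = 3t + 1`, the target becomes `m * s ^ 2`.
  set s : ℝ := m ^ (1 / (3 * (t : ℝ) + 1)) with hsdef
  have hs0 : 0 < s := Real.rpow_pos_of_pos hm0 _
  have hsm : s ^ (3 * t + 1) = m := by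
    rw [hsdef, ← Real.rpow_natCast, ← Real.rpow_mul hm0.le]
    push_cast
    rw [one_div, inv_mul_cancel₀ (by positivity), Real.rpow_one]
  have hexp : m ^ (1 + 2 / (3 * ((t + 1 : ℕ) : ℝ) - 2)) = m * s ^ 2 := by
    rw [Real.rpow_add hm0, Real.rpow_one, hsdef, ← Real.rpow_natCast, ← Real.rpow_mul hm0.le]
    congr 2
    push_cast
    rw [show 3 * ((t : ℝ) + 1) - 2 = 3 * t + 1 by ring]
    ring
  rw [hexp]
  have mono {b b' : ℝ} {ℓ : ℕ} (hb : b ≤ b') (h : HasSensingGraph n ℓ b') :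
      HasSensingGraph n ℓ b := by
    obtain ⟨Γ, I, J, h1, h2, h3, h4, h5, h6, h7⟩ := h
    exact ⟨Γ, I, J, h1, h2, h3, h4, h5, h6, hb.trans h7⟩
  rcases Nat.lt_or_ge t 2 with ht2 | ht2
  · obtain rfl : t = 1 := by omega
    refine mono ?_ (hasSensingGraph_complete hn10)
    have h4 : (s ^ 2) ^ 2 = m := by rw [← hsm]; ring
    have hs4 : 4 ≤ s ^ 2 := by nlinarith [sq_nonneg s]
    have : m * s ^ 2 ≤ m * (m / 4) := mul_le_mul_of_nonneg_left (by nlinarith) hm0.le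
    refine this.trans ?_
    rw [← hmdef]
    nlinarith
  rcases le_or_gt (15 / 8) (s ^ 2) with hs | hs
  · exact hasSensingGraph_greedy hs hs0 ht2 hsm hm
  -- The star has `n + 1 = 2m - 1 ≥ 15m/8` edges.
  · refine mono ?_ (hasSensingGraph_star (t + 1) (by omega))
    have : (n : ℝ) + 1 = 2 * m - 1 := by rw [hmdef]; ring
    rw [this]
    nlinarith

/-! ### The case `ℓ = 1`, where the exponent is `3`. -/

lemma add_one_pow_three_le {n : ℕ} (hn : 3 ≤ n) : (n + 1) ^ 3 ≤ 5 ^ n := by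
  induction n, hn using Nat.le_induction with
  | base => norm_num
  | succ n hn ih =>
    rw [pow_succ 5]
    have : (n + 1 + 1) ^ 3 ≤ (n + 1) ^ 3 * 5 := by nlinarith [sq_nonneg n]
    omega

lemma isSensingMatrix_one {n d : ℕ} {A : Matrix (Fin n) (Fin d) ℝ} (h : ∀ c, A.col c ≠ 0) :
    IsSensingMatrix A 1 := by
  intro x hx hcard hker
  obtain ⟨c, hc⟩ := Function.ne_iff.1 hx
  have hsub := (Set.ncard_le_one (Set.toFinite _)).1 hcard
  have hx' : x = Pi.single c (x c) := by
    ext j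
    by_cases hj : j = c
    · subst hj; simp
    · rw [Pi.single_eq_of_ne hj]
      by_contra hne
      exact hj (hsub j hne c hc)
  rw [hx', Matrix.mulVec_single] at hker
  apply h c
  ext i
  have := congrFun hker i
  simpa [show x c ≠ 0 from hc] using this

/-- All nonzero vectors with entries in `{0, ±1, ±2}` as the columns of a matrix. -/
lemma exists_sensingMatrix_one {n : ℕ} (hn : 3 ≤ n) :
    ∃ (d : ℕ) (A : Matrix (Fin n) (Fin d) ℤ), IsSensingMatrix (A.map (Int.cast : ℤ → ℝ)) 1 ∧
      matrixSupNorm A = 2 ∧ Function.Injective A.col ∧ (((n : ℝ) + 2) / 2) ^ 3 ≤ (d : ℝ) := by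
  classical
  set F : Finset (Fin n → ℤ) :=
    (Fintype.piFinset fun _ => Finset.Icc (-2 : ℤ) 2).erase 0 with hF
  have hcard : F.card = 5 ^ n - 1 := by
    rw [hF, Finset.card_erase_of_mem (by simp [Fintype.mem_piFinset])]
    simp
  set e := F.equivFin.symm with he
  have hmem (c) : (e c).1 ≠ 0 ∧ ∀ i, -2 ≤ (e c).1 i ∧ (e c).1 i ≤ 2 := by
    have := Finset.mem_erase.1 (e c).2
    rw [Fintype.mem_piFinset] at this
    exact ⟨this.1, fun i => Finset.mem_Icc.1 (this.2 i)⟩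
  refine ⟨F.card, Matrix.of fun i c => (e c).1 i, isSensingMatrix_one fun c h => ?_,
    matrixSupNorm_eq_of (fun i c => ?_) ?_, fun c c' h => ?_, ?_⟩
  · apply (hmem c).1
    ext i
    have := congrFun h i
    simpa using this
  · have := (hmem c).2 i
    simp only [Matrix.of_apply]
    omega
  · have h2 : (fun _ => 2 : Fin n → ℤ) ∈ F := by
      rw [hF, Finset.mem_erase, Fintype.mem_piFinset]
      refine ⟨fun h => ?_, fun i => by simp⟩
      have := congrFun h ⟨0, by omega⟩
      simp at this
    refine ⟨⟨0, by omega⟩, e.symm ⟨_, h2⟩, ?_⟩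
    simp
  · exact e.injective (Subtype.ext (funext fun i => congrFun h i))
  · have h1 := add_one_pow_three_le hn
    have h2 : n ^ 3 ≤ F.card := by
      have : n ^ 3 + 1 ≤ (n + 1) ^ 3 := by nlinarith [sq_nonneg n]
      omega
    have h3 : ((n ^ 3 : ℕ) : ℝ) ≤ F.card := Nat.cast_le.2 h2
    have hn' : (3 : ℝ) ≤ n := by exact_mod_cast hn
    refine le_trans ?_ h3
    push_cast
    exact pow_le_pow_left₀ (by positivity) (by linarith) 3

/-! ### Growth of the number of columns, and assembly. -/

/-- The growth rate of the lower bound `m ^ (1 + 2 / (3 ℓ - 2))` on the number of columns. -/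
lemma exp_le_div_of_rpow_le {n ℓ : ℕ} {d ε : ℝ} (hn : 4 ≤ n) (h1 : 1 ≤ ℓ)
    (hℓ : (ℓ : ℝ) ≤ Real.log n ^ (1 - ε))
    (hd : (((n : ℝ) + 2) / 2) ^ (1 + 2 / (3 * (ℓ : ℝ) - 2)) ≤ d) :
    Real.exp (Real.log n ^ ε / 3) / 2 ≤ d / n := by
  have hn' : (4 : ℝ) ≤ n := by exact_mod_cast hn
  have hℓ1 : (1 : ℝ) ≤ ℓ := by exact_mod_cast h1
  have hL : 0 < Real.log n := Real.log_pos (by linarith)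
  set m : ℝ := ((n : ℝ) + 2) / 2 with hm
  have hm0 : 0 < m := by positivity
  -- This is `n ≤ m ^ 2`.
  have hlogm : Real.log n / 2 ≤ Real.log m := by
    rw [div_le_iff₀ (by norm_num), mul_comm, ← Nat.cast_two, ← Real.log_pow]
    refine Real.log_le_log (by linarith) ?_
    rw [hm]
    nlinarith
  have hexp : Real.log n ^ ε / 3 ≤ Real.log m * (2 / (3 * (ℓ : ℝ) - 2)) := by
    have hpow : Real.log n ^ ε * Real.log n ^ (1 - ε) = Real.log n := by
      rw [← Real.rpow_add hL]; simp
    have hε : 0 < Real.log n ^ ε := Real.rpow_pos_of_pos hL _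
    have h2 : Real.log n ^ ε * ℓ ≤ Real.log n :=
      (mul_le_mul_of_nonneg_left hℓ hε.le).trans_eq hpow
    rw [← mul_div_assoc, div_le_div_iff₀ (by norm_num) (by linarith)]
    nlinarith
  have hnpos : (0 : ℝ) < n := by linarith
  rw [div_le_div_iff₀ (by norm_num) hnpos]
  have h3 : m * Real.exp (Real.log n ^ ε / 3) ≤ d := by
    refine le_trans ?_ hd
    rw [Real.rpow_add hm0, Real.rpow_one, Real.rpow_def_of_pos hm0]
    exact mul_le_mul_of_nonneg_left (Real.exp_le_exp.2 hexp) hm0.le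
  have h4 := Real.exp_pos (Real.log n ^ ε / 3)
  have h5 : (n : ℝ) ≤ 2 * m := by rw [hm]; linarith
  nlinarith

lemma exists_sensingMatrix {n ℓ : ℕ} (hn : 2 * 18 ^ 140 ≤ n) (h1 : 1 ≤ ℓ) (hℓ : ℓ ≤ n - 1) :
    ∃ (d : ℕ) (A : Matrix (Fin n) (Fin d) ℤ),
      IsSensingMatrix (A.map (Int.cast : ℤ → ℝ)) ℓ ∧ matrixSupNorm A = 2 ∧
      Function.Injective A.col ∧
      (((n : ℝ) + 2) / 2) ^ (1 + 2 / (3 * (ℓ : ℝ) - 2)) ≤ (d : ℝ) ∧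
      (2 ≤ ℓ → ∃ (Γ : SimpleGraph (Fin (n + 2))) (I J : Set (Fin (n + 2))),
        I.Nonempty ∧ J.Nonempty ∧ I ∪ J = Set.univ ∧ Γ.IsBipartiteWith I J ∧
        (ℓ : ℕ∞) < Γ.egirth ∧ IsEdgeDifferenceMatrix A Γ I J) := by
  rcases Nat.lt_or_ge ℓ 2 with h2 | h2
  · obtain rfl : ℓ = 1 := by omega
    obtain ⟨d, A, hs, hnorm, hinj, hd⟩ :=
      exists_sensingMatrix_one (le_trans (by norm_num) hn : 3 ≤ n)
    refine ⟨d, A, hs, hnorm, hinj, ?_, fun h => absurd h (by norm_num)⟩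
    convert hd using 1
    rw [← Real.rpow_natCast]
    norm_num
  · obtain ⟨Γ, I, J, hI, hJ, hIJ, hbip, hg, hedge, hcard⟩ := hasSensingGraph_of_large hn h2
    obtain ⟨A, hs, hnorm, hinj, hdiff⟩ :=
      exists_edgeDifferenceMatrix h2 (hℓ.trans (Nat.sub_le _ _)) hbip hg hedge
    exact ⟨_, A, hs, hnorm, hinj, hcard, fun _ => ⟨Γ, I, J, hI, hJ, hIJ, hbip, hg, hdiff⟩⟩

theorem mainTheorem3 :
    ∃ (N : ℕ) (d : ℕ → ℕ → ℕ) (A : (n ℓ : ℕ) → Matrix (Fin n) (Fin (d n ℓ)) ℤ),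
      (∀ n : ℕ, N ≤ n → ∀ ℓ : ℕ, 1 ≤ ℓ → ℓ ≤ n - 1 →
        IsSensingMatrix ((A n ℓ).map (Int.cast : ℤ → ℝ)) ℓ ∧
        matrixSupNorm (A n ℓ) = 2 ∧
        Function.Injective (A n ℓ).col ∧
        (((n : ℝ) + 2) / 2) ^ (1 + 2 / (3 * (ℓ : ℝ) - 2)) ≤ (d n ℓ : ℝ) ∧
        (2 ≤ ℓ → ∃ (Γ : SimpleGraph (Fin (n + 2))) (I J : Set (Fin (n + 2))),
          I.Nonempty ∧ J.Nonempty ∧ I ∪ J = Set.univ ∧ Γ.IsBipartiteWith I J ∧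
          (ℓ : ℕ∞) < Γ.egirth ∧ IsEdgeDifferenceMatrix (A n ℓ) Γ I J)) ∧
      (∀ ε : ℝ, 0 < ε → ∀ ℓ : ℕ → ℕ,
        (∀ᶠ n : ℕ in Filter.atTop, 1 ≤ ℓ n ∧ (ℓ n : ℝ) ≤ (Real.log n) ^ (1 - ε)) →
        Filter.Tendsto (fun n : ℕ => (d n (ℓ n) : ℝ) / (n : ℝ)) Filter.atTop Filter.atTop) := by
  have hex (n ℓ : ℕ) : ∃ (d : ℕ) (A : Matrix (Fin n) (Fin d) ℤ),
      2 * 18 ^ 140 ≤ n → 1 ≤ ℓ → ℓ ≤ n - 1 →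
      IsSensingMatrix (A.map (Int.cast : ℤ → ℝ)) ℓ ∧ matrixSupNorm A = 2 ∧
      Function.Injective A.col ∧
      (((n : ℝ) + 2) / 2) ^ (1 + 2 / (3 * (ℓ : ℝ) - 2)) ≤ (d : ℝ) ∧
      (2 ≤ ℓ → ∃ (Γ : SimpleGraph (Fin (n + 2))) (I J : Set (Fin (n + 2))),
        I.Nonempty ∧ J.Nonempty ∧ I ∪ J = Set.univ ∧ Γ.IsBipartiteWith I J ∧
        (ℓ : ℕ∞) < Γ.egirth ∧ IsEdgeDifferenceMatrix A Γ I J) := by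
    by_cases h : 2 * 18 ^ 140 ≤ n ∧ 1 ≤ ℓ ∧ ℓ ≤ n - 1
    · obtain ⟨d, A, hA⟩ := exists_sensingMatrix h.1 h.2.1 h.2.2
      exact ⟨d, A, fun _ _ _ => hA⟩
    · exact ⟨0, 0, fun h1 h2 h3 => (h ⟨h1, h2, h3⟩).elim⟩
  choose d A hA using hex
  refine ⟨2 * 18 ^ 140, d, A, fun n hn ℓ h1 h2 => hA n ℓ hn h1 h2, fun ε hε ℓ hℓ => ?_⟩
  have hlog : Filter.Tendsto (fun n : ℕ => Real.log n) Filter.atTop Filter.atTop :=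
    Real.tendsto_log_atTop.comp tendsto_natCast_atTop_atTop
  have hlim : Filter.Tendsto (fun n : ℕ => Real.exp (Real.log n ^ ε / 3) / 2)
      Filter.atTop Filter.atTop :=
    (Real.tendsto_exp_atTop.comp (((tendsto_rpow_atTop hε).comp hlog).atTop_div_const
      (by norm_num))).atTop_div_const (by norm_num)
  refine Filter.tendsto_atTop_mono' _ ?_ hlim
  filter_upwards [hℓ, Filter.eventually_ge_atTop (2 * 18 ^ 140), hlog.eventually_ge_atTop 1]
    with n hn hN hL
  have h4 : 4 ≤ n := le_trans (by norm_num) hN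
  -- The growth bound keeps `ℓ n` in the admissible range: `(log n)^(1-ε) ≤ log n ≤ n - 1`.
  have hle : ℓ n ≤ n - 1 := by
    have h5 : Real.log n ^ (1 - ε) ≤ Real.log n := by
      conv_rhs => rw [← Real.rpow_one (Real.log n)]
      exact Real.rpow_le_rpow_of_exponent_le hL (by linarith)
    have h6 := Real.log_le_sub_one_of_pos (show (0 : ℝ) < n by positivity)
    have h7 : ((ℓ n + 1 : ℕ) : ℝ) ≤ n := by push_cast; linarith [hn.2]
    have h8 : ℓ n + 1 ≤ n := by exact_mod_cast h7
    omega
  exact exp_le_div_of_rpow_le h4 hn.1 hn.2 (hA n (ℓ n) hN hn.1 hle).2.2.2.1
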